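/- Let $D\subset\mathbb{R}^{d_D}$ and $\mathcal{T}\subset\mathbb{R}^{d_{\mathcal{T}}}$ ($d_D,d_{\mathcal{T}}\ge 1$) be compact and convex, and let $\mathcal{T}$ have positive Lebesgue measure. Let $k$ be a covariance kernel on $D\times\mathcal{T}$ for which there are constants $C,\alpha_1,\alpha_2>0$ such that, for all $\mathbf{x},\mathbf{x}'\in D$ and $t,t'\in\mathcal{T}$, $$k\big((\mathbf{x},t),(\mathbf{x},t)\big)+k\big((\mathbf{x}',t'),(\mathbf{x}',t')\big)-2k\big((\mathbf{x},t),(\mathbf{x}',t')\big)\le C\max\big(\|\mathbf{x}-\mathbf{x}'\|_\infty^{\alpha_1},\|t-t'\|_\infty^{\alpha_2}\big).$$ Let $Z=(Z_{\mathbf{x},t})_{(\mathbf{x},t)\in D\times\mathcal{T}}$ be a centred Gaussian process with covariance kernel $k$ on a probability space $(\Omega,\mathcal{F},P)$. Assume that $Z$ is measurable (that is, $((\mathbf{x},t),\omega)\mapsto Z_{\mathbf{x},t}(\omega)$ is jointly measurable) and separable (that is, there are a countable dense set $S_0\subset D\times\mathcal{T}$ and an event $N$ with $P(N)=0$ such that,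 for every relatively open $E\subset D\times\mathcal{T}$ and every closed $B\subset\mathbb{R}$, the sets $\{\omega: Z_s(\omega)\in B\ \forall s\in E\}$ and $\{\omega: Z_s(\omega)\in B\ \forall s\in E\cap S_0\}$ differ only on a subset of $N$). Then, almost surely, the map $\mathbf{x}\mapsto Z_{\mathbf{x},\cdot}$ takes its values in the bounded functions on $\mathcal{T}$ and is $\beta$-Hölder continuous in sup norm for every $\beta\in(0,\alpha_1/2)$: for almost every $\omega$, every function $Z_{\mathbf{x},\cdot}(\omega)$ with $\mathbf{x}\in D$ is bounded, and for every $0<\beta<\alpha_1/2$ there is a finite $K=K(\omega,\beta)$ with $$\sup_{t\in\mathcal{T}}\big|Z_{\mathbf{x},t}(\omega)-Z_{\mathbf{x}',t}(\omega)\big|\le K\,\|\mathbf{x}-\mathbf{x}'\|_\infty^{\beta}\qquad\text{for all }\mathbf{x},\mathbf{x}'\in D.$$ -/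

import Mathlib

open MeasureTheory ProbabilityTheory
open scoped ENNReal NNReal

/-- The canonical semi-distance of a kernel (in the customary squared form):
`d²_k(s, s') = k(s, s) + k(s', s') - 2 k(s, s')`. -/
def canonicalSemiDistSq {S : Type*} (k : S → S → ℝ) (s s' : S) : ℝ :=
  k s s + k s' s' - 2 * k s s'

/-- The Hölder-type condition on a kernel on `D × T`, with constant `C` and exponents `α₁` in the
spatial variable and `α₂` in the response variable. The norm of `Fin d → ℝ` is the sup norm. -/
def KernelHolderCondition {dD dT : ℕ} {D : Set (Fin dD → ℝ)} {T : Set (Fin dT → ℝ)}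
    (k : D × T → D × T → ℝ) (C α₁ α₂ : ℝ) : Prop :=
  0 < C ∧ 0 < α₁ ∧ 0 < α₂ ∧ ∀ (x x' : D) (t t' : T),
    canonicalSemiDistSq k (x, t) (x', t') ≤
      C * max (‖(x : Fin dD → ℝ) - (x' : Fin dD → ℝ)‖ ^ α₁)
        (‖(t : Fin dT → ℝ) - (t' : Fin dT → ℝ)‖ ^ α₂)

/-- `Z ∼ GP(0, k)`: a centred Gaussian process with covariance kernel `k`. -/
structure IsCentredGP {Ω S : Type*} [MeasurableSpace Ω] (Z : S → Ω → ℝ) (k : S → S → ℝ)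
    (P : Measure Ω) : Prop where
  isGaussianProcess : IsGaussianProcess Z P
  mean_eq_zero : ∀ s, ∫ ω, Z s ω ∂P = 0
  covariance_eq : ∀ s s', cov[Z s, Z s'; P] = k s s'

/-- A measurable random field: jointly measurable in the index and in the chance parameter. -/
def IsMeasurableField {Ω S : Type*} [MeasurableSpace Ω] [MeasurableSpace S]
    (Z : S → Ω → ℝ) : Prop :=
  Measurable fun p : S × Ω => Z p.1 p.2

/-- A separable random field: there are a countable dense set `S₀` of indices and a null event `N`
such that for every open set `E` of indices and every closed set `B` of reals, the sets
`{ω | Z s ω ∈ B for all s ∈ E}` and `{ω | Z s ω ∈ B for all s ∈ E ∩ S₀}` differ from each other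
only on a subset of `N`. -/
def IsSeparableField {Ω S : Type*} [MeasurableSpace Ω] [TopologicalSpace S]
    (Z : S → Ω → ℝ) (P : Measure Ω) : Prop :=
  ∃ S₀ : Set S, S₀.Countable ∧ Dense S₀ ∧
    ∃ N : Set Ω, MeasurableSet N ∧ P N = 0 ∧
      ∀ (E : Set S) (B : Set ℝ), IsOpen E → IsClosed B →
        symmDiff {ω | ∀ s ∈ E, Z s ω ∈ B} {ω | ∀ s ∈ E ∩ S₀, Z s ω ∈ B} ⊆ N

/-- The sup norm of a real function, with value `∞` when the function is unbounded. -/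
noncomputable def supNorm {T : Type*} (f : T → ℝ) : ℝ≥0∞ := ⨆ t, ‖f t‖ₑ

/-- For `z : D × T → ℝ`, the map `x ↦ z (x, ·)` takes values in the space of bounded functions on
`T` with the sup norm and is `β`-Hölder continuous there:
`‖z (x, ·) - z (x', ·)‖_∞ ≤ K ‖x - x'‖_∞ ^ β` for all `x, x'`, with a finite constant `K`. -/
def IsHolderInSupNorm {dD : ℕ} {D : Set (Fin dD → ℝ)} {T : Type*} (β : ℝ)
    (z : D × T → ℝ) : Prop :=
  (∀ x : D, supNorm (fun t : T => z (x, t)) < ∞) ∧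
    ∃ K : ℝ≥0, ∀ x x' : D,
      supNorm (fun t : T => z (x, t) - z (x', t)) ≤
        ENNReal.ofReal (K * ‖(x : Fin dD → ℝ) - (x' : Fin dD → ℝ)‖ ^ β)

/-!
The proof is a chaining argument of Kolmogorov–Chentsov type, run with respect to an anisotropic
distance on `D × T`.

Since `x` and `t` enter the kernel condition with different exponents, an isotropic argument would
only give the exponent `min α₁ α₂ / 2`. Instead, let `l = max α₁ α₂ / 2`, `a = α₁ / (2 * l)` and
`b = α₂ / (2 * l)`. As `a, b ≤ 1`, the maximum of `‖x - x'‖ ^ a` and `‖t - t'‖ ^ b` is a metric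
(`anisoDist`), and the kernel condition says that the standard deviation of an increment of `Z` is
at most a constant times `anisoDist ^ l`. The increments are Gaussian, so their moments of every
order `p` are bounded by a constant times `anisoDist ^ (l * p)`
(`IsCentredGP.exists_lintegral_enorm_sub_pow_le`).

Bounded sets have nets of mesh `2⁻ⁿ` in this metric with at most `A * Q ^ n` points
(`exists_finset_net_anisoDist`). For `γ < l`, a moment of sufficiently high order outweighs the
number of pairs of net points, so almost surely one finite random constant controls the increments
over all nets (`ae_exists_forall_abs_sub_le_of_moments`). Telescoping along the nets turns this into
a `γ`-Hölder bound on the countable separating set (`exists_forall_abs_sub_le_of_chaining`), and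
separability extends it to all indices (`IsSeparableField.ae_forall_abs_sub_le`). For two indices
with the same `t` the distance is `‖x - x'‖ ^ a`, and `a * l = α₁ / 2`, so every exponent
`β < α₁ / 2` is reached.
-/

open Filter Topology

/-! ### Moments of Gaussian increments -/

theorem lintegral_enorm_pow_gaussianReal (v : ℝ≥0) (p : ℕ) :
    ∫⁻ x, ‖x‖ₑ ^ p ∂gaussianReal 0 v =
      ‖√(v : ℝ)‖ₑ ^ p * ∫⁻ x, ‖x‖ₑ ^ p ∂gaussianReal 0 1 := by
  have hmap : (gaussianReal 0 1).map (√(v : ℝ) * ·) = gaussianReal 0 v := by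
    rw [gaussianReal_map_const_mul]
    congr 1
    · simp
    · ext
      simp
  rw [← hmap, lintegral_map (by fun_prop) (by fun_prop),
    ← lintegral_const_mul _ (by fun_prop)]
  simp only [enorm_mul, mul_pow]

theorem lintegral_enorm_pow_gaussianReal_lt_top (v : ℝ≥0) (p : ℕ) :
    ∫⁻ x, ‖x‖ₑ ^ p ∂gaussianReal 0 v < ∞ := by
  rcases eq_or_ne p 0 with rfl | hp
  · simp
  have h := lintegral_rpow_enorm_lt_top_of_eLpNorm_lt_top (by exact_mod_cast hp)
    (ENNReal.natCast_ne_top p) (memLp_id_gaussianReal' (μ := 0) (v := v) p (by simp)).eLpNorm_lt_top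
  simpa using h

/-- The increments of a centred Gaussian process are centred Gaussian variables whose variance is
the squared canonical semi-distance, so their absolute moments are those of a scaled standard
Gaussian variable. -/
theorem IsCentredGP.lintegral_enorm_sub_pow {Ω S : Type*} [MeasurableSpace Ω] {P : Measure Ω}
    [IsProbabilityMeasure P] {Z : S → Ω → ℝ} {k : S → S → ℝ} (hZ : IsCentredGP Z k P)
    (s s' : S) (p : ℕ) :
    ∫⁻ ω, ‖Z s ω - Z s' ω‖ₑ ^ p ∂P =
      ‖√(canonicalSemiDistSq k s s')‖ₑ ^ p * ∫⁻ x, ‖x‖ₑ ^ p ∂gaussianReal 0 1 := by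
  have hG := hZ.isGaussianProcess
  have hm (s : S) : MemLp (Z s) 2 P := (hG.hasGaussianLaw_eval s).memLp_two
  have hsub : HasGaussianLaw (fun ω => Z s ω - Z s' ω) P := hG.hasGaussianLaw_fun_sub
  have hmean : ∫ ω, Z s ω - Z s' ω ∂P = 0 := by
    rw [integral_sub ((hm s).integrable (by norm_num)) ((hm s').integrable (by norm_num)),
      hZ.mean_eq_zero, hZ.mean_eq_zero, sub_zero]
  have hvar : Var[fun ω => Z s ω - Z s' ω; P] = canonicalSemiDistSq k s s' := by
    rw [variance_fun_sub (hm s) (hm s'), ← covariance_self (hm s).aemeasurable,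
      ← covariance_self (hm s').aemeasurable, hZ.covariance_eq, hZ.covariance_eq,
      hZ.covariance_eq, canonicalSemiDistSq]
    ring
  have h0 : 0 ≤ canonicalSemiDistSq k s s' := hvar ▸ variance_nonneg _ _
  have hlaw := hsub.map_eq_gaussianReal
  rw [hmean, hvar] at hlaw
  rw [← lintegral_map' (f := fun x : ℝ => ‖x‖ₑ ^ p) (by fun_prop) hsub.aemeasurable, hlaw,
    lintegral_enorm_pow_gaussianReal, Real.coe_toNNReal _ h0]

/-! ### Extension of bounds by separability -/

/-- Outside a null set, a continuous bound on the increments that holds on the countable set of a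
separable field holds for all pairs of indices. The null set does not depend on the bound. -/
theorem IsSeparableField.ae_forall_abs_sub_le {Ω S : Type*} [MeasurableSpace Ω]
    [TopologicalSpace S] {P : Measure Ω} {Z : S → Ω → ℝ} (hZ : IsSeparableField Z P) :
    ∃ S₀ : Set S, S₀.Countable ∧ ∀ᵐ ω ∂P, ∀ g : S → S → ℝ, Continuous (fun q : S × S => g q.1 q.2) →
      (∀ s ∈ S₀, ∀ s' ∈ S₀, |Z s ω - Z s' ω| ≤ g s s') → ∀ s s', |Z s ω - Z s' ω| ≤ g s s' := by
  obtain ⟨S₀, hS₀, -, N, -, hN, hsep⟩ := hZ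
  refine ⟨S₀, hS₀, ?_⟩
  filter_upwards [measure_eq_zero_iff_ae_notMem.1 hN] with ω hω g hg h s s'
  have key : ∀ (E : Set S) (B : Set ℝ), IsOpen E → IsClosed B →
      (∀ u ∈ E, u ∈ S₀ → Z u ω ∈ B) → ∀ u ∈ E, Z u ω ∈ B := by
    intro E B hE hB hEB
    by_contra hcon
    exact hω (hsep E B hE hB (Or.inr ⟨fun u hu => hEB u hu.1 hu.2, hcon⟩))
  refine le_of_forall_gt_imp_ge_of_dense fun c hc => ?_
  obtain ⟨E, E', hE, hE', hs, hs', hsub⟩ :=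
    isOpen_prod_iff.1 (isOpen_lt hg (continuous_const (y := c))) s s' hc
  have hball (y : ℝ) : IsClosed {z : ℝ | |z - y| ≤ c} :=
    isClosed_le (by fun_prop) continuous_const
  -- The bound is extended in one variable at a time.
  have h1 : ∀ u' ∈ E', u' ∈ S₀ → |Z s ω - Z u' ω| ≤ c := fun u' hu' hu'₀ =>
    key E _ hE (hball (Z u' ω))
      (fun u hu hu₀ => (h u hu₀ u' hu'₀).trans (hsub (Set.mk_mem_prod hu hu')).le) s hs
  have h2 := key E' _ hE' (hball (Z s ω))
    (fun u' hu' hu'₀ => by simpa [abs_sub_comm] using h1 u' hu' hu'₀) s' hs'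
  simpa [abs_sub_comm] using h2

/-! ### Chaining -/

/-- The deterministic part of the chaining argument. The functions `π n` approximate every index up
to `2⁻ⁿ`, and the increments of `f` over points of `F n` satisfy a Hölder bound of exponent `l`,
with a loss `2 ^ (n * (l - γ))`. The term `2⁻ⁿ` added to the distance keeps the bound
positive at coinciding points and does no harm at the scale `n`. Telescoping along `π n s → s` then
gives exponent `γ`. -/
theorem exists_forall_abs_sub_le_of_chaining {S : Type*} {δ : S → S → ℝ}
    (hcomm : ∀ s s', δ s s' = δ s' s) (htri : ∀ s u s', δ s s' ≤ δ s u + δ u s')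
    (hpos : ∀ s s', s ≠ s' → 0 < δ s s') {B : ℝ} (hB : 0 < B) (hδB : ∀ s s', δ s s' ≤ B)
    (hself : ∀ s, δ s s = 0)
    {F : ℕ → Finset S} {π : ℕ → S → S} (hπF : ∀ n s, π n s ∈ F n)
    (hπF' : ∀ n s, π (n + 1) s ∈ F n) (hπ : ∀ n s, δ s (π n s) ≤ (1 / 2) ^ n)
    {l γ K : ℝ} (hγ : 0 < γ) (hγl : γ ≤ l) (hK : 0 ≤ K) {f : S → ℝ}
    (hf : ∀ n, ∀ s ∈ F n, ∀ s' ∈ F n, |f s - f s'| ≤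
      K * (((1 / 2 : ℝ) ^ n) ^ (γ - l) * (δ s s' + (1 / 2) ^ n) ^ l))
    {S₀ : Set S} (hlim : ∀ s ∈ S₀, Tendsto (fun n => f (π n s)) atTop (𝓝 (f s))) :
    ∃ K' : ℝ, 0 ≤ K' ∧ ∀ s ∈ S₀, ∀ s' ∈ S₀, |f s - f s'| ≤ K' * δ s s' ^ γ := by
  have hl : 0 < l := hγ.trans_le hγl
  have h2 (n : ℕ) : (0 : ℝ) < (1 / 2) ^ n := by positivity
  have hnn (s s' : S) : 0 ≤ δ s s' := by
    rcases eq_or_ne s s' with rfl | h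
    · exact (hself s).ge
    · exact (hpos s s' h).le
  have hbd (n : ℕ) (c : ℝ) (hc : 0 ≤ c) (s : S) (hs : s ∈ F n) (s' : S) (hs' : s' ∈ F n)
      (hss : δ s s' + (1 / 2) ^ n ≤ c * (1 / 2) ^ n) :
      |f s - f s'| ≤ K * c ^ l * ((1 / 2) ^ γ) ^ n := by
    have e : ((1 / 2 : ℝ) ^ γ) ^ n = ((1 / 2 : ℝ) ^ n) ^ (γ - l) * ((1 / 2 : ℝ) ^ n) ^ l := by
      rw [← Real.rpow_add (h2 n), sub_add_cancel, Real.rpow_pow_comm (by norm_num)]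
    calc |f s - f s'| ≤ _ := hf n s hs s' hs'
      _ ≤ K * (((1 / 2 : ℝ) ^ n) ^ (γ - l) * (c * (1 / 2) ^ n) ^ l) := by
        have := hnn s s'
        have := h2 n
        gcongr
      _ = _ := by rw [Real.mul_rpow hc (h2 n).le, e]; ring
  set r : ℝ := (1 / 2) ^ γ with hr
  have hr0 : 0 < r := by positivity
  have hr1 : r < 1 := Real.rpow_lt_one (by norm_num) (by norm_num) hγ
  -- The links from scale `m` to scale `m + 1` decay geometrically.
  have hchain (s : S) (hs : s ∈ S₀) (n : ℕ) :
      |f (π n s) - f s| ≤ K * 4 ^ l * r ^ n / (1 - r) := by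
    rw [← Real.dist_eq]
    refine dist_le_of_le_geometric_of_tendsto r _ hr1 (fun m => ?_) (hlim s hs) n
    rw [Real.dist_eq]
    refine hbd m 4 (by norm_num) _ (hπF m s) _ (hπF' m s) ?_
    have h3 := htri (π m s) s (π (m + 1) s)
    have h4 := hπ m s
    have h5 := hπ (m + 1) s
    rw [hcomm (π m s) s] at h3
    rw [pow_succ] at h5
    linarith [h2 m]
  refine ⟨(2 * (K * 4 ^ l / (1 - r)) + K * (B + 3) ^ l) * (2 / B) ^ γ, ?_, ?_⟩
  · have : 0 < 1 - r := by linarith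
    positivity
  intro s hs s' hs'
  rcases eq_or_ne s s' with rfl | hne
  · simp [hself, Real.zero_rpow hγ.ne']
  -- The scale `n` at which `δ s s'` is comparable to `B * 2⁻ⁿ`.
  obtain ⟨n, hn1, hn2⟩ := exists_nat_pow_near_of_lt_one (x := δ s s' / B) (y := (1 / 2 : ℝ))
    (div_pos (hpos s s' hne) hB) ((div_le_one hB).2 (hδB s s')) (by norm_num) (by norm_num)
  have hlink : |f (π n s) - f (π n s')| ≤ K * (B + 3) ^ l * r ^ n := by
    refine hbd n (B + 3) (by positivity) _ (hπF n s) _ (hπF n s') ?_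
    have h3 := htri (π n s) s (π n s')
    have h4 := htri s s' (π n s')
    have h5 := hπ n s
    have h6 := hπ n s'
    rw [hcomm (π n s) s] at h3
    rw [div_le_iff₀ hB] at hn2
    linarith
  have hrn : r ^ n ≤ (2 / B) ^ γ * δ s s' ^ γ := by
    rw [hr, Real.rpow_pow_comm (by norm_num), ← Real.mul_rpow (by positivity) (hnn _ _)]
    refine Real.rpow_le_rpow (h2 n).le ?_ hγ.le
    rw [pow_succ] at hn1
    calc (1 / 2 : ℝ) ^ n = 2 * ((1 / 2) ^ n * (1 / 2)) := by ring
      _ ≤ 2 * (δ s s' / B) := by gcongr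
      _ = _ := by ring
  have htot : |f s - f s'| ≤ |f (π n s) - f s| + |f (π n s) - f (π n s')|
      + |f (π n s') - f s'| := by
    rw [abs_sub_comm (f (π n s)) (f s)]
    refine (abs_sub_le _ (f (π n s')) _).trans ?_
    gcongr
    exact abs_sub_le _ _ _
  have h1r : 0 < 1 - r := by linarith
  calc |f s - f s'| ≤ (2 * (K * 4 ^ l / (1 - r)) + K * (B + 3) ^ l) * r ^ n := by
        refine htot.trans ((add_le_add (add_le_add (hchain s hs n) hlink)
          (hchain s' hs' n)).trans_eq ?_)
        ring
    _ ≤ (2 * (K * 4 ^ l / (1 - r)) + K * (B + 3) ^ l) * ((2 / B) ^ γ * δ s s' ^ γ) := by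
        gcongr
    _ = _ := by ring

/-- The random constant needed for chaining. The weighted `p`-th moments of the increments over
`F n × F n` sum over `n` to a finite value as soon as `p` is large enough for the weights
`2 ^ (-n * p * (l - γ))` to beat the number of pairs. No restriction to neighbouring
pairs is needed. -/
theorem ae_exists_forall_abs_sub_le_of_moments {Ω S : Type*} [MeasurableSpace Ω] {P : Measure Ω}
    {Z : S → Ω → ℝ} (hZ : ∀ s, Measurable (Z s)) {δ : S → S → ℝ} (hδ : ∀ s s', 0 ≤ δ s s')
    {l γ : ℝ} (hγl : γ < l) (hl : 0 ≤ l)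
    (hmom : ∀ p : ℕ, ∃ c : ℝ≥0∞, c ≠ ∞ ∧ ∀ s s',
      ∫⁻ ω, ‖Z s ω - Z s' ω‖ₑ ^ p ∂P ≤ c * ENNReal.ofReal (δ s s' ^ l) ^ p)
    {F : ℕ → Finset S} {A Q : ℕ} (hF : ∀ n, (F n).card ≤ A * Q ^ n) :
    ∀ᵐ ω ∂P, ∃ K : ℝ, 0 ≤ K ∧ ∀ n, ∀ s ∈ F n, ∀ s' ∈ F n, |Z s ω - Z s' ω| ≤
      K * (((1 / 2 : ℝ) ^ n) ^ (γ - l) * (δ s s' + (1 / 2) ^ n) ^ l) := by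
  have h2 (n : ℕ) : (0 : ℝ) < (1 / 2) ^ n := by positivity
  set q : ℝ≥0∞ := ENNReal.ofReal ((1 / 2 : ℝ) ^ (l - γ)) with hq
  have hq1 : q < 1 := by
    rw [hq, ENNReal.ofReal_lt_one]
    exact Real.rpow_lt_one (by norm_num) (by norm_num) (by linarith)
  obtain ⟨p, hp, hp1⟩ : ∃ p : ℕ, (Q : ℝ≥0∞) ^ 2 * q ^ p < 1 ∧ 1 ≤ p := by
    have h := ENNReal.Tendsto.const_mul (a := (Q : ℝ≥0∞) ^ 2)
      (ENNReal.tendsto_pow_atTop_nhds_zero_of_lt_one hq1) (Or.inr (by simp))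
    rw [mul_zero] at h
    exact ((h.eventually_lt_const one_pos).and (eventually_ge_atTop 1)).exists
  obtain ⟨c, hc, hmom⟩ := hmom p
  set w : ℕ → S → S → ℝ := fun n s s' =>
    ((1 / 2 : ℝ) ^ n) ^ (γ - l) * (δ s s' + (1 / 2) ^ n) ^ l with hw
  have hw0 (n : ℕ) (s s' : S) : 0 < w n s s' := by
    have := hδ s s'
    have := h2 n
    positivity
  set X : ℕ → Ω → ℝ≥0∞ := fun n ω => ∑ s ∈ F n, ∑ s' ∈ F n,
    ‖Z s ω - Z s' ω‖ₑ ^ p * (ENNReal.ofReal (w n s s'))⁻¹ ^ p with hX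
  have hXm (n : ℕ) : Measurable (X n) := by
    refine Finset.measurable_fun_sum _ fun s _ => Finset.measurable_fun_sum _ fun s' _ => ?_
    have := hZ s
    have := hZ s'
    fun_prop
  have hterm (n : ℕ) (s s' : S) : ∫⁻ ω, ‖Z s ω - Z s' ω‖ₑ ^ p *
      (ENNReal.ofReal (w n s s'))⁻¹ ^ p ∂P ≤ c * (q ^ p) ^ n := by
    have := hZ s
    have := hZ s'
    rw [lintegral_mul_const _ (by fun_prop)]
    have hle : ENNReal.ofReal (δ s s' ^ l) * (ENNReal.ofReal (w n s s'))⁻¹ ≤ q ^ n := by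
      rw [← ENNReal.ofReal_inv_of_pos (hw0 n s s'),
        ← ENNReal.ofReal_mul (Real.rpow_nonneg (hδ s s') _), hq,
        ← ENNReal.ofReal_pow (by positivity), Real.rpow_pow_comm (by norm_num)]
      refine ENNReal.ofReal_le_ofReal ?_
      rw [← div_eq_mul_inv, div_le_iff₀ (hw0 n s s'), hw, ← mul_assoc, ← Real.rpow_add (h2 n),
        sub_add_sub_cancel, sub_self, Real.rpow_zero, one_mul]
      exact Real.rpow_le_rpow (hδ s s') (by linarith [h2 n]) hl
    calc _ ≤ c * ENNReal.ofReal (δ s s' ^ l) ^ p * (ENNReal.ofReal (w n s s'))⁻¹ ^ p := by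
          gcongr
          exact hmom s s'
      _ = c * (ENNReal.ofReal (δ s s' ^ l) * (ENNReal.ofReal (w n s s'))⁻¹) ^ p := by
          rw [mul_pow, mul_assoc]
      _ ≤ c * (q ^ n) ^ p := by gcongr
      _ = _ := by rw [← pow_mul, ← pow_mul, mul_comm n p]
  have hXn (n : ℕ) : ∫⁻ ω, X n ω ∂P ≤ (A : ℝ≥0∞) ^ 2 * c * ((Q : ℝ≥0∞) ^ 2 * q ^ p) ^ n := by
    have hcard : ((F n).card : ℝ≥0∞) ≤ A * (Q : ℝ≥0∞) ^ n := by exact_mod_cast hF n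
    have hm (s s' : S) : Measurable fun ω => ‖Z s ω - Z s' ω‖ₑ ^ p *
        (ENNReal.ofReal (w n s s'))⁻¹ ^ p := by
      have := hZ s
      have := hZ s'
      fun_prop
    calc ∫⁻ ω, X n ω ∂P = ∑ s ∈ F n, ∑ s' ∈ F n, ∫⁻ ω, ‖Z s ω - Z s' ω‖ₑ ^ p *
          (ENNReal.ofReal (w n s s'))⁻¹ ^ p ∂P := by
          rw [hX, lintegral_finsetSum _ fun s _ => Finset.measurable_fun_sum _ fun s' _ => hm s s']
          refine Finset.sum_congr rfl fun s _ => ?_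
          rw [lintegral_finsetSum _ fun s' _ => hm s s']
      _ ≤ ∑ s ∈ F n, ∑ s' ∈ F n, c * (q ^ p) ^ n :=
          Finset.sum_le_sum fun s _ => Finset.sum_le_sum fun s' _ => hterm n s s'
      _ = (F n).card * ((F n).card * (c * (q ^ p) ^ n)) := by simp
      _ ≤ (A * (Q : ℝ≥0∞) ^ n) * ((A * (Q : ℝ≥0∞) ^ n) * (c * (q ^ p) ^ n)) := by gcongr
      _ = _ := by ring
  have hfin : ∫⁻ ω, ∑' n, X n ω ∂P ≠ ∞ := by
    rw [lintegral_tsum fun n => (hXm n).aemeasurable]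
    refine ne_top_of_le_ne_top ?_ (ENNReal.tsum_le_tsum hXn)
    rw [ENNReal.tsum_mul_left, ENNReal.tsum_geometric]
    refine ENNReal.mul_ne_top (ENNReal.mul_ne_top (by simp) hc) ?_
    exact ENNReal.inv_ne_top.2 (tsub_pos_of_lt hp).ne'
  filter_upwards [ae_lt_top (Measurable.tsum hXm) hfin] with ω hω
  set M : ℝ≥0∞ := ∑' n, X n ω
  have hM : max 1 M ≠ ∞ := by simp [hω.ne]
  refine ⟨(max 1 M).toReal, ENNReal.toReal_nonneg, fun n s hs s' hs' => ?_⟩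
  set y : ℝ≥0∞ := ‖Z s ω - Z s' ω‖ₑ * (ENNReal.ofReal (w n s s'))⁻¹ with hy
  have hyM : y ^ p ≤ M := by
    rw [hy, mul_pow]
    refine le_trans ?_ (ENNReal.le_tsum n)
    refine le_trans ?_ (Finset.single_le_sum (fun _ _ => zero_le) hs)
    exact Finset.single_le_sum (f := fun s' => ‖Z s ω - Z s' ω‖ₑ ^ p *
      (ENNReal.ofReal (w n s s'))⁻¹ ^ p) (fun _ _ => zero_le) hs'
  -- `max 1 M` replaces the `p`-th root of `M`.
  have hy1 : y ≤ max 1 M := by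
    rcases le_total y 1 with h | h
    · exact h.trans (le_max_left _ _)
    · exact (le_self_pow h (by omega)).trans (hyM.trans (le_max_right _ _))
  rw [hy, ← div_eq_mul_inv, ENNReal.div_le_iff (by simpa using hw0 n s s') (by simp),
    ← ENNReal.ofReal_toReal hM, ← ENNReal.ofReal_mul ENNReal.toReal_nonneg,
    Real.enorm_eq_ofReal_abs] at hy1
  exact (ENNReal.ofReal_le_ofReal_iff (mul_nonneg ENNReal.toReal_nonneg (hw0 n s s').le)).1 hy1

theorem ae_tendsto_of_moments {Ω S : Type*} [MeasurableSpace Ω] {P : Measure Ω}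
    {Z : S → Ω → ℝ} (hZ : ∀ s, Measurable (Z s)) {δ : S → S → ℝ} (hδ : ∀ s s', 0 ≤ δ s s')
    {l : ℝ} (hl : 0 < l) {c : ℝ≥0∞} (hc : c ≠ ∞)
    (hmom : ∀ s s', ∫⁻ ω, ‖Z s ω - Z s' ω‖ₑ ∂P ≤ c * ENNReal.ofReal (δ s s' ^ l))
    {u : ℕ → S} {s : S} (hu : ∀ n, δ s (u n) ≤ (1 / 2) ^ n) :
    ∀ᵐ ω ∂P, Tendsto (fun n => Z (u n) ω) atTop (𝓝 (Z s ω)) := by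
  have hm (n : ℕ) : Measurable fun ω => ‖Z s ω - Z (u n) ω‖ₑ := by
    have := hZ s
    have := hZ (u n)
    fun_prop
  have hq1 : ENNReal.ofReal ((1 / 2 : ℝ) ^ l) < 1 := by
    rw [ENNReal.ofReal_lt_one]
    exact Real.rpow_lt_one (by norm_num) (by norm_num) hl
  have hfin : ∫⁻ ω, ∑' n, ‖Z s ω - Z (u n) ω‖ₑ ∂P ≠ ∞ := by
    rw [lintegral_tsum fun n => (hm n).aemeasurable]
    refine ne_top_of_le_ne_top (b := ∑' n, c * ENNReal.ofReal ((1 / 2 : ℝ) ^ l) ^ n) ?_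
      (ENNReal.tsum_le_tsum fun n => (hmom s (u n)).trans ?_)
    · rw [ENNReal.tsum_mul_left, ENNReal.tsum_geometric]
      exact ENNReal.mul_ne_top hc (ENNReal.inv_ne_top.2 (tsub_pos_of_lt hq1).ne')
    · rw [← ENNReal.ofReal_pow (by positivity), Real.rpow_pow_comm (by norm_num)]
      gcongr
      · exact hδ _ _
      · exact hu n
  filter_upwards [ae_lt_top (Measurable.tsum hm) hfin] with ω hω
  rw [tendsto_iff_edist_tendsto_0]
  simpa [edist_eq_enorm_sub, enorm_sub_rev] using
    ENNReal.tendsto_atTop_zero_of_tsum_ne_top hω.ne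

/-! ### Finite nets of polynomial size -/

/-- A bounded set in dimension `d` has nets of mesh `1 / N` with at most `(A * N) ^ d` points of the
set: one point is taken from every nonempty cell of the grid of side `1 / N`. -/
theorem exists_finset_net_of_isBounded {d : ℕ} {D : Set (Fin d → ℝ)}
    (hD : Bornology.IsBounded D) :
    ∃ A : ℕ, ∀ N : ℕ, 0 < N → ∃ F : Finset D, F.card ≤ (A * N) ^ d ∧
      ∀ x : D, ∃ y ∈ F, ‖(x : Fin d → ℝ) - y‖ ≤ 1 / N := by
  classical
  obtain ⟨R₀, hR₀⟩ := hD.exists_norm_le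
  obtain ⟨R, hR⟩ := exists_nat_ge R₀
  refine ⟨2 * R + 1, fun N hN => ?_⟩
  have hN' : (0 : ℝ) < N := by exact_mod_cast hN
  set cell : D → Fin d → ℤ := fun x i => ⌊(x : Fin d → ℝ) i * N⌋ with hcell
  set G : Finset (Fin d → ℤ) :=
    Fintype.piFinset fun _ => Finset.Icc (-(R * N : ℤ)) (R * N) with hG
  have hmem (x : D) : cell x ∈ G := by
    rw [hG, Fintype.mem_piFinset]
    intro i
    have h : |(x : Fin d → ℝ) i| ≤ R :=
      ((norm_le_pi_norm (x : Fin d → ℝ) i).trans (hR₀ x x.2)).trans hR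
    rw [abs_le] at h
    rw [Finset.mem_Icc, hcell, Int.le_floor]
    constructor
    · push_cast
      nlinarith
    · have : ((⌊(x : Fin d → ℝ) i * N⌋ : ℤ) : ℝ) ≤ ((R * N : ℤ) : ℝ) := by
        refine (Int.floor_le _).trans ?_
        push_cast
        nlinarith
      exact_mod_cast this
  have hsub : Set.range cell ⊆ G := by
    rintro _ ⟨x, rfl⟩
    exact hmem x
  have : Fintype (Set.range cell) := (G.finite_toSet.subset hsub).fintype
  refine ⟨Finset.univ.image (Set.rangeSplitting cell), ?_, fun x => ?_⟩
  · calc _ ≤ Fintype.card (Set.range cell) := Finset.card_image_le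
      _ = (Set.range cell).toFinset.card := (Set.toFinset_card _).symm
      _ ≤ G.card := Finset.card_le_card (Set.toFinset_subset.2 hsub)
      _ = (2 * (R * N) + 1) ^ d := by
        rw [hG, Fintype.card_piFinset_const, Int.card_Icc]
        congr 1
        omega
      _ ≤ _ := by
        gcongr
        nlinarith
  · refine ⟨Set.rangeSplitting cell ⟨cell x, x, rfl⟩,
      Finset.mem_image_of_mem _ (Finset.mem_univ _), ?_⟩
    have hy := Set.apply_rangeSplitting cell ⟨cell x, x, rfl⟩
    set y := Set.rangeSplitting cell ⟨cell x, x, rfl⟩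
    rw [pi_norm_le_iff_of_nonneg (by positivity)]
    intro i
    have h := Int.abs_sub_lt_one_of_floor_eq_floor (congrFun hy i)
    rw [← sub_mul, abs_mul, abs_of_pos hN', ← lt_div_iff₀ hN', abs_sub_comm] at h
    exact h.le

/-! ### The anisotropic distance -/

section Anisotropic

variable {dD dT : ℕ} {D : Set (Fin dD → ℝ)} {T : Set (Fin dT → ℝ)}

/-- The anisotropic distance `max (‖x - x'‖ ^ a) (‖t - t'‖ ^ b)` on `D × T`. It is a metric when
`a` and `b` lie in `(0, 1]`. -/
noncomputable def anisoDist (a b : ℝ) (s s' : D × T) : ℝ :=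
  max (‖(s.1 : Fin dD → ℝ) - (s'.1 : Fin dD → ℝ)‖ ^ a)
    (‖(s.2 : Fin dT → ℝ) - (s'.2 : Fin dT → ℝ)‖ ^ b)

variable {a b : ℝ}

theorem anisoDist_nonneg (s s' : D × T) : 0 ≤ anisoDist a b s s' :=
  le_max_of_le_left (by positivity)

theorem anisoDist_comm (s s' : D × T) : anisoDist a b s s' = anisoDist a b s' s := by
  simp only [anisoDist, norm_sub_rev]

theorem anisoDist_self (ha : 0 < a) (hb : 0 < b) (s : D × T) : anisoDist a b s s = 0 := by
  simp [anisoDist, Real.zero_rpow ha.ne', Real.zero_rpow hb.ne']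

theorem anisoDist_pos {s s' : D × T} (h : s ≠ s') : 0 < anisoDist a b s s' := by
  rw [anisoDist, lt_max_iff]
  by_cases h1 : s.1 = s'.1
  · right
    have h2 : s.2 ≠ s'.2 := fun h2 => h (Prod.ext h1 h2)
    exact Real.rpow_pos_of_pos (norm_pos_iff.2 (sub_ne_zero.2 (Subtype.coe_ne_coe.2 h2))) _
  · left
    exact Real.rpow_pos_of_pos (norm_pos_iff.2 (sub_ne_zero.2 (Subtype.coe_ne_coe.2 h1))) _

theorem rpow_norm_sub_le_add {E : Type*} [SeminormedAddCommGroup E] (ha : 0 < a) (ha1 : a ≤ 1)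
    (x y z : E) : ‖x - z‖ ^ a ≤ ‖x - y‖ ^ a + ‖y - z‖ ^ a :=
  (Real.rpow_le_rpow (norm_nonneg _) (norm_sub_le_norm_sub_add_norm_sub x y z) ha.le).trans
    (Real.rpow_add_le_add_rpow (norm_nonneg _) (norm_nonneg _) ha.le ha1)

theorem anisoDist_triangle (ha : 0 < a) (ha1 : a ≤ 1) (hb : 0 < b) (hb1 : b ≤ 1)
    (s u s' : D × T) : anisoDist a b s s' ≤ anisoDist a b s u + anisoDist a b u s' :=
  max_le
    ((rpow_norm_sub_le_add ha ha1 _ (u.1 : Fin dD → ℝ) _).trans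
      (add_le_add (le_max_left _ _) (le_max_left _ _)))
    ((rpow_norm_sub_le_add hb hb1 _ (u.2 : Fin dT → ℝ) _).trans
      (add_le_add (le_max_right _ _) (le_max_right _ _)))

theorem continuous_anisoDist (ha : 0 < a) (hb : 0 < b) :
    Continuous fun q : (D × T) × (D × T) => anisoDist a b q.1 q.2 := by
  unfold anisoDist
  exact ((by fun_prop : Continuous fun q : (D × T) × (D × T) =>
      ‖(q.1.1 : Fin dD → ℝ) - (q.2.1 : Fin dD → ℝ)‖).rpow_const fun _ => Or.inr ha.le).max
    ((by fun_prop : Continuous fun q : (D × T) × (D × T) =>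
      ‖(q.1.2 : Fin dT → ℝ) - (q.2.2 : Fin dT → ℝ)‖).rpow_const fun _ => Or.inr hb.le)

theorem exists_norm_sub_le_of_isBounded {d : ℕ} {D : Set (Fin d → ℝ)}
    (hD : Bornology.IsBounded D) : ∃ R : ℝ, 0 < R ∧ ∀ x x' : D, ‖(x : Fin d → ℝ) - x'‖ ≤ R := by
  obtain ⟨R, hR0, hR⟩ := hD.exists_pos_norm_le
  exact ⟨R + R, by positivity, fun x x' =>
    (norm_sub_le _ _).trans (add_le_add (hR x x.2) (hR x' x'.2))⟩

theorem exists_anisoDist_le (ha : 0 < a) (hb : 0 < b) (hD : Bornology.IsBounded D)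
    (hT : Bornology.IsBounded T) :
    ∃ B : ℝ, 0 < B ∧ ∀ s s' : D × T, anisoDist a b s s' ≤ B := by
  obtain ⟨R, hR0, hR⟩ := exists_norm_sub_le_of_isBounded hD
  obtain ⟨R', -, hR'⟩ := exists_norm_sub_le_of_isBounded hT
  exact ⟨max (R ^ a) (R' ^ b), lt_max_of_lt_left (by positivity), fun s s' => max_le_max
    (Real.rpow_le_rpow (norm_nonneg _) (hR _ _) ha.le)
    (Real.rpow_le_rpow (norm_nonneg _) (hR' _ _) hb.le)⟩

theorem exists_finset_net_anisoDist (ha : 0 < a) (hb : 0 < b) (hD : Bornology.IsBounded D)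
    (hT : Bornology.IsBounded T) :
    ∃ A Q : ℕ, ∀ n : ℕ, ∃ F : Finset (D × T), F.card ≤ A * Q ^ n ∧
      ∀ s, ∃ u ∈ F, anisoDist a b s u ≤ (1 / 2) ^ n := by
  obtain ⟨A₁, hA₁⟩ := exists_finset_net_of_isBounded hD
  obtain ⟨A₂, hA₂⟩ := exists_finset_net_of_isBounded hT
  obtain ⟨m, hm⟩ := exists_nat_ge (max (1 / a) (1 / b))
  have hma : 1 ≤ m * a := (div_le_iff₀ ha).1 ((le_max_left _ _).trans hm)
  have hmb : 1 ≤ m * b := (div_le_iff₀ hb).1 ((le_max_right _ _).trans hm)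
  -- A mesh of size `2 ^ (-n * m)` has powers with exponents `a` and `b` below `2 ^ (-n)`.
  have hpow (n : ℕ) (e : ℝ) (he : 1 ≤ m * e) (he0 : 0 < e) {r : ℝ} (hr : 0 ≤ r)
      (h : r ≤ 1 / ((2 ^ (m * n) : ℕ) : ℝ)) : r ^ e ≤ (1 / 2) ^ n := by
    calc r ^ e ≤ ((1 / 2 : ℝ) ^ (m * n)) ^ e := by
          refine Real.rpow_le_rpow hr (h.trans_eq ?_) he0.le
          push_cast
          rw [one_div_pow]
      _ = ((1 / 2 : ℝ) ^ n) ^ (m * e) := by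
          rw [mul_comm m n, pow_mul, Real.rpow_mul (by positivity), Real.rpow_natCast]
      _ ≤ ((1 / 2 : ℝ) ^ n) ^ (1 : ℝ) :=
          Real.rpow_le_rpow_of_exponent_ge (by positivity)
            (pow_le_one₀ (by norm_num) (by norm_num)) he
      _ = _ := Real.rpow_one _
  refine ⟨A₁ ^ dD * A₂ ^ dT, 2 ^ (m * (dD + dT)), fun n => ?_⟩
  obtain ⟨F₁, hF₁, hF₁'⟩ := hA₁ (2 ^ (m * n)) (by positivity)
  obtain ⟨F₂, hF₂, hF₂'⟩ := hA₂ (2 ^ (m * n)) (by positivity)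
  refine ⟨F₁ ×ˢ F₂, ?_, fun s => ?_⟩
  · rw [Finset.card_product]
    refine (Nat.mul_le_mul hF₁ hF₂).trans_eq ?_
    rw [mul_pow, mul_pow, ← pow_mul, ← pow_mul, ← pow_mul]
    ring
  · obtain ⟨y, hy, hxy⟩ := hF₁' s.1
    obtain ⟨v, hv, htv⟩ := hF₂' s.2
    exact ⟨(y, v), Finset.mk_mem_product hy hv,
      max_le (hpow n a hma ha (norm_nonneg _) hxy) (hpow n b hmb hb (norm_nonneg _) htv)⟩

/-! ### Hölder bounds for random fields on `D × T` -/

/-- Uniform Hölder bound with respect to `anisoDist`, obtained by chaining on a countable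
separating set and extended to all indices by separability. -/
theorem ae_exists_forall_abs_sub_le_anisoDist {Ω : Type*} [MeasurableSpace Ω] {P : Measure Ω}
    (hD : Bornology.IsBounded D) (hT : Bornology.IsBounded T)
    (ha : 0 < a) (ha1 : a ≤ 1) (hb : 0 < b) (hb1 : b ≤ 1)
    {Z : D × T → Ω → ℝ} (hZ : ∀ s, Measurable (Z s)) (hsep : IsSeparableField Z P)
    {l γ : ℝ} (hγ : 0 < γ) (hγl : γ < l)
    (hmom : ∀ p : ℕ, ∃ c : ℝ≥0∞, c ≠ ∞ ∧ ∀ s s',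
      ∫⁻ ω, ‖Z s ω - Z s' ω‖ₑ ^ p ∂P ≤ c * ENNReal.ofReal (anisoDist a b s s' ^ l) ^ p) :
    ∀ᵐ ω ∂P, ∃ K : ℝ, 0 ≤ K ∧ ∀ s s', |Z s ω - Z s' ω| ≤ K * anisoDist a b s s' ^ γ := by
  classical
  have hl := hγ.trans hγl
  obtain ⟨B, hB, hδB⟩ := exists_anisoDist_le ha hb hD hT
  obtain ⟨A, Q, hnet⟩ := exists_finset_net_anisoDist ha hb hD hT
  choose G hG π hπG hπ using hnet
  -- Two consecutive nets are joined, so that one bound covers the links between them.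
  set F : ℕ → Finset (D × T) := fun n => G n ∪ G (n + 1) with hFdef
  have hF (n : ℕ) : (F n).card ≤ (A * (1 + Q)) * Q ^ n :=
    (Finset.card_union_le _ _).trans ((add_le_add (hG n) (hG (n + 1))).trans_eq (by ring))
  obtain ⟨S₀, hS₀, hsep⟩ := hsep.ae_forall_abs_sub_le
  obtain ⟨c, hc, hmom1⟩ := hmom 1
  simp only [pow_one] at hmom1
  have hlim : ∀ᵐ ω ∂P, ∀ s ∈ S₀, Tendsto (fun n => Z (π n s) ω) atTop (𝓝 (Z s ω)) :=
    (ae_ball_iff hS₀).2 fun s _ =>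
      ae_tendsto_of_moments hZ anisoDist_nonneg hl hc hmom1 fun n => hπ n s
  filter_upwards [hsep, hlim,
    ae_exists_forall_abs_sub_le_of_moments hZ anisoDist_nonneg hγl hl.le hmom hF]
    with ω hω hlimω ⟨K, hK, hKω⟩
  obtain ⟨K', hK', hbd⟩ := exists_forall_abs_sub_le_of_chaining anisoDist_comm
    (anisoDist_triangle ha ha1 hb hb1) (fun _ _ => anisoDist_pos) hB hδB
    (anisoDist_self ha hb) (F := F) (π := π)
    (fun n s => Finset.mem_union_left _ (hπG n s))
    (fun n s => Finset.mem_union_right _ (hπG (n + 1) s)) hπ hγ hγl.le hK hKω hlimω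
  refine ⟨K', hK', hω _ ?_ hbd⟩
  exact continuous_const.mul
    ((continuous_anisoDist ha hb).rpow_const fun _ => Or.inr hγ.le)

end Anisotropic

theorem supNorm_le_ofReal {T : Type*} {f : T → ℝ} {M : ℝ} (h : ∀ t, |f t| ≤ M) :
    supNorm f ≤ ENNReal.ofReal M :=
  iSup_le fun t => by
    rw [Real.enorm_eq_ofReal_abs]
    exact ENNReal.ofReal_le_ofReal (h t)

/-- Under the Hölder condition on the kernel, all absolute moments of the increments are bounded by
multiples of the corresponding powers of `anisoDist a b ^ l`. -/
theorem IsCentredGP.exists_lintegral_enorm_sub_pow_le {dD dT : ℕ} {D : Set (Fin dD → ℝ)}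
    {T : Set (Fin dT → ℝ)} {Ω : Type*} [MeasurableSpace Ω] {P : Measure Ω}
    [IsProbabilityMeasure P] {k : D × T → D × T → ℝ} {C a b l : ℝ} (hl : 0 < l)
    (hk : KernelHolderCondition k C (a * (2 * l)) (b * (2 * l)))
    {Z : D × T → Ω → ℝ} (hZ : IsCentredGP Z k P) (p : ℕ) :
    ∃ c : ℝ≥0∞, c ≠ ∞ ∧ ∀ s s', ∫⁻ ω, ‖Z s ω - Z s' ω‖ₑ ^ p ∂P ≤
      c * ENNReal.ofReal (anisoDist a b s s' ^ l) ^ p := by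
  refine ⟨ENNReal.ofReal (√C) ^ p * ∫⁻ x, ‖x‖ₑ ^ p ∂gaussianReal 0 1,
    ENNReal.mul_ne_top (by simp) (lintegral_enorm_pow_gaussianReal_lt_top 1 p).ne, fun s s' => ?_⟩
  have h0 := anisoDist_nonneg (a := a) (b := b) s s'
  have hsq : canonicalSemiDistSq k s s' ≤ C * (anisoDist a b s s' ^ l) ^ 2 := by
    refine (hk.2.2.2 s.1 s'.1 s.2 s'.2).trans (mul_le_mul_of_nonneg_left ?_ hk.1.le)
    rw [← Real.rpow_mul_natCast h0, Nat.cast_ofNat, mul_comm l 2, Real.rpow_mul (norm_nonneg _),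
      Real.rpow_mul (norm_nonneg _)]
    have h2l : 0 ≤ 2 * l := by positivity
    exact max_le (Real.rpow_le_rpow (by positivity) (le_max_left _ _) h2l)
      (Real.rpow_le_rpow (by positivity) (le_max_right _ _) h2l)
  have hsqrt : ‖√(canonicalSemiDistSq k s s')‖ₑ ≤
      ENNReal.ofReal (√C) * ENNReal.ofReal (anisoDist a b s s' ^ l) := by
    rw [Real.enorm_of_nonneg (Real.sqrt_nonneg _), ← ENNReal.ofReal_mul (Real.sqrt_nonneg _)]
    refine ENNReal.ofReal_le_ofReal ((Real.sqrt_le_sqrt hsq).trans_eq ?_)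
    rw [Real.sqrt_mul hk.1.le, Real.sqrt_sq (Real.rpow_nonneg h0 _)]
  rw [hZ.lintegral_enorm_sub_pow]
  calc _ ≤ (ENNReal.ofReal (√C) * ENNReal.ofReal (anisoDist a b s s' ^ l)) ^ p *
        ∫⁻ x, ‖x‖ₑ ^ p ∂gaussianReal 0 1 := by gcongr
    _ = _ := by ring

theorem mainTheorem10
    {dD dT : ℕ} (hdD : 1 ≤ dD) (hdT : 1 ≤ dT)
    (D : Set (Fin dD → ℝ)) (hD_compact : IsCompact D) (hD_convex : Convex ℝ D)
    (T : Set (Fin dT → ℝ)) (hT_compact : IsCompact T) (hT_convex : Convex ℝ T)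
    (hT_volume : 0 < volume T)
    {Ω : Type*} [MeasurableSpace Ω] (P : Measure Ω) [IsProbabilityMeasure P]
    (k : D × T → D × T → ℝ) (C α₁ α₂ : ℝ) (hk : KernelHolderCondition k C α₁ α₂)
    (Z : D × T → Ω → ℝ) (hZ : IsCentredGP Z k P)
    (hZ_meas : IsMeasurableField Z) (hZ_sep : IsSeparableField Z P) :
    ∀ᵐ ω ∂P, ∀ β : ℝ, 0 < β → β < α₁ / 2 →
      IsHolderInSupNorm β (fun s : D × T => Z s ω) := by
  have hα₁ : 0 < α₁ := hk.2.1
  have hα₂ : 0 < α₂ := hk.2.2.1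
  have hD := hD_compact.isBounded
  have hT := hT_compact.isBounded
  have hZm (s : D × T) : Measurable (Z s) := hZ_meas.comp measurable_prodMk_left
  -- Dividing both exponents by the larger one makes `anisoDist` a metric.
  set l : ℝ := max α₁ α₂ / 2 with hl_def
  have hl : 0 < l := half_pos (lt_max_of_lt_left hα₁)
  set a : ℝ := α₁ / (2 * l) with ha_def
  set b : ℝ := α₂ / (2 * l) with hb_def
  have h2l : 2 * l = max α₁ α₂ := by rw [hl_def]; ring
  have ha : 0 < a := by positivity
  have hb : 0 < b := by positivity
  have ha1 : a ≤ 1 := (div_le_one (by positivity)).2 (h2l ▸ le_max_left _ _)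
  have hb1 : b ≤ 1 := (div_le_one (by positivity)).2 (h2l ▸ le_max_right _ _)
  have hal : a * (2 * l) = α₁ := div_mul_cancel₀ _ (by positivity)
  have hbl : b * (2 * l) = α₂ := div_mul_cancel₀ _ (by positivity)
  rw [← hal, ← hbl] at hk
  -- Rational exponents suffice for a null set that is independent of `β`.
  have hall : ∀ᵐ ω ∂P, ∀ q : ℚ, 0 < (q : ℝ) → (q : ℝ) < α₁ / 2 → ∃ K : ℝ, 0 ≤ K ∧
      ∀ s s', |Z s ω - Z s' ω| ≤ K * anisoDist a b s s' ^ (q / a) := by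
    refine ae_all_iff.2 fun q => ?_
    by_cases hq : 0 < (q : ℝ) ∧ (q : ℝ) < α₁ / 2
    · have hql : q / a < l := (div_lt_iff₀ ha).2 (hq.2.trans_eq (by rw [← hal]; ring))
      filter_upwards [ae_exists_forall_abs_sub_le_anisoDist hD hT ha ha1 hb hb1 hZm hZ_sep
        (div_pos hq.1 ha) hql (hZ.exists_lintegral_enorm_sub_pow_le hl hk)] with ω hω _ _
      exact hω
    · exact Eventually.of_forall fun ω h1 h2 => absurd ⟨h1, h2⟩ hq
  obtain ⟨R, hR0, hR⟩ := exists_norm_sub_le_of_isBounded hD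
  obtain ⟨B, hB, hδB⟩ := exists_anisoDist_le ha hb hD hT
  obtain ⟨t₀, ht₀⟩ := nonempty_of_measure_ne_zero hT_volume.ne'
  filter_upwards [hall] with ω hω β hβ hβα
  obtain ⟨q, hβq, hqα⟩ := exists_rat_btwn hβα
  have hq : (0 : ℝ) < q := hβ.trans hβq
  obtain ⟨K, hK, hbd⟩ := hω q hq hqα
  refine ⟨fun x => (supNorm_le_ofReal (M := |Z (x, ⟨t₀, ht₀⟩) ω| + K * B ^ (q / a))
    fun t => ?_).trans_lt ENNReal.ofReal_lt_top, NNReal.mk (K * R ^ (q - β)) (by positivity),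
    fun x x' => supNorm_le_ofReal fun t => ?_⟩
  · have h1 := hbd (x, t) (x, ⟨t₀, ht₀⟩)
    have h2 : anisoDist a b (x, t) (x, ⟨t₀, ht₀⟩) ^ (q / a) ≤ B ^ (q / a) :=
      Real.rpow_le_rpow (anisoDist_nonneg _ _) (hδB _ _) (by positivity)
    have h3 := abs_sub_abs_le_abs_sub (Z (x, t) ω) (Z (x, ⟨t₀, ht₀⟩) ω)
    have h4 := mul_le_mul_of_nonneg_left h2 hK
    linarith
  -- At equal `t` the distance is `‖x - x'‖ ^ a`; lowering the exponent `q` to `β` costs a power of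
  -- the diameter of `D`.
  · have he : anisoDist a b (x, t) (x', t) ^ (q / a) =
        ‖(x : Fin dD → ℝ) - (x' : Fin dD → ℝ)‖ ^ (q : ℝ) := by
      simp only [anisoDist, sub_self, norm_zero, Real.zero_rpow hb.ne']
      rw [max_eq_left (by positivity), ← Real.rpow_mul (norm_nonneg _), mul_div_cancel₀ _ ha.ne']
    have h1 := hbd (x, t) (x', t)
    rw [he, ← sub_add_cancel (q : ℝ) β,
      Real.rpow_add' (norm_nonneg _) (by rw [sub_add_cancel]; exact hq.ne')] at h1
    calc _ ≤ _ := h1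
      _ ≤ K * (R ^ (q - β) * ‖(x : Fin dD → ℝ) - (x' : Fin dD → ℝ)‖ ^ β) := by
        gcongr
        exact hR x x'
      _ = _ := by
        rw [NNReal.coe_mk]
        ring
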